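/- Consider a two-player zero-sum discounted stochastic game with a finite state space $\mathcal S$, action sets $A_1=A_2=[0,1]$, discount factor $0\le\beta<1$, payoffs $r(s,a_1,a_2)=\sum_{i,j}r_{ij}(s)\,a_1^i a_2^j$ that are real polynomials, and transition probabilities $p(s';s,a_1)$ (from $s$ to $s'$) that depend only on the action of player 1 and are polynomials in $a_1$, with $p(s';s,a_1)\ge 0$ and $\sum_{s'}p(s';s,a_1)=1$ for all $a_1\in[0,1]$. A mixed strategy vector is a family $\mu=(\mu(s))_{s\in\mathcal S}$ of probability measures on $[0,1]$. For mixed strategy vectors $\mu$ (player 1, maximizer) and $\nu$ (player 2, minimizer) put $P_{ss'}(\mu)=\int p(s';s,a_1)\,d\mu(s)$, $r(\mu,\nu)_s=\int\!\int r(s,a_1,a_2)\,d\mu(s)\,d\nu(s)$ and $\mathbf v_\beta(\mu,\nu)=(I-\beta P(\mu))^{-1}r(\mu,\nu)\in\mathbb R^{\mathcal S}$, the vector of discounted values. Let $n$ bound the degrees in $a_1$ of all $r(s,\cdot,\cdot)$ and all $p(s';s,\cdot)$, and let $m$ bound the degrees in $a_2$ of all $r(s,\cdot,\cdot)$. Let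 $\mathcal M_k\subset\mathbb R^{k+1}$ be the set of vectors $(\int x^i\,d\mu)_{0\le i\le k}$ for finite nonnegative measures $\mu$ on $[0,1]$. Consider the programs $(P')$: minimize $\sum_s v(s)$ over $v(s)\in\mathbb R$ and $\bar\nu(s)\in\mathbb R^{m+1}$ subject to, for every $s$: $v(s)-\sum_{i,j}r_{ij}(s)a_1^i\nu_j(s)-\beta\sum_{s'}p(s';s,a_1)v(s')\ge 0$ for all $a_1\in[0,1]$, $\ \bar\nu(s)\in\mathcal M_m$, $\ \nu_0(s)=1$. $(D')$: maximize $\sum_s\alpha(s)$ over $\alpha(s)\in\mathbb R$ and $\bar\xi(s)\in\mathbb R^{n+1}$ subject to: $\sum_{i,j}r_{ij}(s)\xi_i(s)a_2^j-\alpha(s)\ge 0$ for all $s$ and all $a_2\in[0,1]$; $\ \bar\xi(s)\in\mathcal M_n$ for all $s$; and $\sum_s\int(\delta(s,s')-\beta p(s';s,a_1))\,d\xi(s)=1$ for all $s'$, where the integral denotes the linear form in the moments $\bar\xi(s)$ obtained by replacing $a_1^i$ by $\xi_i(s)$. Then: (1) both programs attain their optimal values $p^*$ and $d^*$, and $p^*=d^*$.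 Moreover, let $(\bar\nu^*,\mathbf v^*)$ be any optimal solution of $(P')$ and $(\bar\xi^*,\alpha^*)$ any optimal solution of $(D')$, let $\nu^*(s)$ and $\xi^*(s)$ be any finite nonnegative measures on $[0,1]$ with moment vectors $\bar\nu^*(s)$ and $\bar\xi^*(s)$, and let $\mu^*(s)=\xi^*(s)/\int d\xi^*(s)$. Then $\mu^*$ and $\nu^*$ are mixed strategy vectors, and: (2) $\mathbf v^*=\mathbf v_\beta(\mu^*,\nu^*)$; (3) $\mathbf v_\beta(\mu,\nu^*)\le\mathbf v_\beta(\mu^*,\nu^*)\le\mathbf v_\beta(\mu^*,\nu)$ componentwise for all mixed strategy vectors $\mu,\nu$; that is, $(\mu^*,\nu^*)$ is a pair of equilibrium strategies. -/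

import Mathlib

open MeasureTheory

noncomputable section

/-- A two-player zero-sum discounted stochastic game with finite state space `σ`, action sets
`A₁ = A₂ = [0,1]`, polynomial payoffs and polynomial transition probabilities which depend only on
the action of player 1 (single-controller assumption).

`r s` is the payoff polynomial in state `s`, as a bivariate polynomial whose inner variable is the
action `a₁` of player 1 and whose outer variable is the action `a₂` of player 2.
`p s' s` is the probability of moving to `s'` from `s`, as a polynomial in `a₁`. -/
structure SingleControllerGame (σ : Type*) [Fintype σ] where
  r : σ → Polynomial (Polynomial ℝ)
  p : σ → σ → Polynomial ℝ
  β : ℝ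
  β_nonneg : 0 ≤ β
  β_lt_one : β < 1
  p_nonneg : ∀ s' s, ∀ a ∈ Set.Icc (0 : ℝ) 1, 0 ≤ (p s' s).eval a
  p_sum : ∀ s, ∀ a ∈ Set.Icc (0 : ℝ) 1, ∑ s', (p s' s).eval a = 1

/-- A vector of mixed strategies: one probability measure on `[0,1]` for each state. -/
def IsMixedStrategy {σ : Type*} (μ : σ → Measure unitInterval) : Prop :=
  ∀ s, IsProbabilityMeasure (μ s)

/-- `y = [y₀, …, y_n]` is the vector of the first `n + 1` moments of the measure `μ`. -/
def HasMoments {n : ℕ} (μ : Measure unitInterval) (y : Fin (n + 1) → ℝ) : Prop :=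
  ∀ k : Fin (n + 1), y k = ∫ x : unitInterval, (x : ℝ) ^ (k : ℕ) ∂μ

/-- The moment space `M([0,1]) ⊆ ℝ^{n+1}`: vectors of the first `n + 1` moments of the finite
nonnegative measures on `[0,1]`. -/
def momentSpace (n : ℕ) : Set (Fin (n + 1) → ℝ) :=
  {y | ∃ μ : Measure unitInterval, IsFiniteMeasure μ ∧ HasMoments μ y}

/-- The univariate real polynomials that are nonnegative on `[0,1]`. -/
def nonnegPolys : Set (Polynomial ℝ) :=
  {q | ∀ a ∈ Set.Icc (0 : ℝ) 1, 0 ≤ q.eval a}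

/-- The integral of the polynomial `q` (of degree at most `n`) against a measure with moment
vector `y`, written as a linear form in `y`. -/
def momentIntegral {n : ℕ} (y : Fin (n + 1) → ℝ) (q : Polynomial ℝ) : ℝ :=
  ∑ i : Fin (n + 1), q.coeff i * y i

/-- The linear form `momentIntegral` is integration against any representing measure. -/
theorem momentIntegral_eq_integral {n : ℕ} {y : Fin (n + 1) → ℝ} {μ : Measure unitInterval}
    [IsFiniteMeasure μ] (h : HasMoments μ y) {q : Polynomial ℝ} (hq : q.natDegree ≤ n) :
    momentIntegral y q = ∫ x : unitInterval, q.eval (x : ℝ) ∂μ := by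
  have h1 : ∀ x : unitInterval, q.eval (x : ℝ)
      = ∑ i : Fin (n + 1), q.coeff i * (x : ℝ) ^ (i : ℕ) := by
    intro x
    rw [Polynomial.eval_eq_sum_range' (Nat.lt_succ_of_le hq), Finset.sum_range]
  simp_rw [h1]
  rw [integral_finsetSum]
  · simp_rw [integral_const_mul, momentIntegral, h _]
  · intro i _
    exact (by fun_prop : Continuous fun x : unitInterval =>
      q.coeff i * (x : ℝ) ^ (i : ℕ)).integrable_of_hasCompactSupport
        (HasCompactSupport.of_compactSpace _)

namespace SingleControllerGame

variable {σ : Type*} [Fintype σ] (G : SingleControllerGame σ)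

/-- The coefficient `r_{ij}(s)` of `a₁ ^ i * a₂ ^ j` in the payoff polynomial of state `s`. -/
def payoffCoeff (s : σ) (i j : ℕ) : ℝ := ((G.r s).coeff j).coeff i

/-- All transition polynomials and all payoffs have degree at most `n` in `a₁`, and all payoffs
have degree at most `m` in `a₂`. -/
def DegreeLE (n m : ℕ) : Prop :=
  (∀ s' s, (G.p s' s).natDegree ≤ n) ∧
    (∀ s j, ((G.r s).coeff j).natDegree ≤ n) ∧
    (∀ s, (G.r s).natDegree ≤ m)

/-- The vector `r(μ, ν)` of expected one-stage payoffs. -/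
def stagePayoff (μ ν : σ → Measure unitInterval) (s : σ) : ℝ :=
  ∫ a₂ : unitInterval, ∫ a₁ : unitInterval,
    (G.r s).evalEval (a₁ : ℝ) (a₂ : ℝ) ∂(μ s) ∂(ν s)

/-- The transition matrix `P(μ)` with entries `P_{ij}(μ) = ∫ p(j; i, a₁) dμ(i)`. -/
def transitionMatrix (μ : σ → Measure unitInterval) : Matrix σ σ ℝ :=
  Matrix.of fun i j => ∫ a : unitInterval, (G.p j i).eval (a : ℝ) ∂(μ i)

/-- The discounted value vector `v_β(μ, ν) = (I - β P(μ))⁻¹ r(μ, ν)`. -/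
def discountedValue [DecidableEq σ] (μ ν : σ → Measure unitInterval) : σ → ℝ :=
  (1 - G.β • G.transitionMatrix μ)⁻¹.mulVec (G.stagePayoff μ ν)

/-- For mixed strategies the matrix `I - β P(μ)` is invertible. -/
theorem isUnit_det [DecidableEq σ] {μ : σ → Measure unitInterval} (hμ : IsMixedStrategy μ) :
    IsUnit (1 - G.β • G.transitionMatrix μ).det := by
  rw [isUnit_iff_ne_zero]
  have hnn : ∀ i j, 0 ≤ G.transitionMatrix μ i j := fun i j =>
    integral_nonneg fun a => G.p_nonneg j i a a.2
  have hsum : ∀ i, ∑ j, G.transitionMatrix μ i j = 1 := by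
    intro i
    have := hμ i
    simp only [transitionMatrix, Matrix.of_apply]
    rw [← integral_finsetSum]
    · have h1 : ∀ a : unitInterval, ∑ j, (G.p j i).eval (a : ℝ) = 1 := fun a => G.p_sum i a a.2
      simp [h1]
    · intro j _
      exact (by fun_prop : Continuous fun a : unitInterval =>
        (G.p j i).eval (a : ℝ)).integrable_of_hasCompactSupport
          (HasCompactSupport.of_compactSpace _)
  apply det_ne_zero_of_sum_row_lt_diag
  intro k
  have h1 : ∑ j ∈ Finset.univ.erase k, ‖(1 - G.β • G.transitionMatrix μ) k j‖
      = G.β * (1 - G.transitionMatrix μ k k) := by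
    rw [← hsum k, ← Finset.add_sum_erase _ _ (Finset.mem_univ k), add_sub_cancel_left,
      Finset.mul_sum]
    refine Finset.sum_congr rfl fun j hj => ?_
    have hkj : k ≠ j := (Finset.ne_of_mem_erase hj).symm
    simp [Matrix.one_apply_ne hkj, abs_of_nonneg G.β_nonneg, abs_of_nonneg (hnn k j)]
  rw [h1]
  have h2 := le_abs_self (1 - G.β * G.transitionMatrix μ k k)
  have h3 := G.β_lt_one
  simp only [Matrix.sub_apply, Matrix.one_apply_eq, Matrix.smul_apply, smul_eq_mul,
    Real.norm_eq_abs]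
  linarith

/-- For mixed strategies the discounted value vector is the unique solution of the recursion
`v(s) = r(s, μ(s), ν(s)) + β ∑_{s'} P_{s s'}(μ) v(s')`. -/
theorem eq_discountedValue_iff [DecidableEq σ] {μ : σ → Measure unitInterval}
    (hμ : IsMixedStrategy μ) (ν : σ → Measure unitInterval) (v : σ → ℝ) :
    v = G.discountedValue μ ν ↔
      ∀ s, v s = G.stagePayoff μ ν s + G.β * ∑ s', G.transitionMatrix μ s s' * v s' := by
  have hu := G.isUnit_det hμ
  have key : (1 - G.β • G.transitionMatrix μ).mulVec v = G.stagePayoff μ ν ↔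
      ∀ s, v s = G.stagePayoff μ ν s + G.β * ∑ s', G.transitionMatrix μ s s' * v s' := by
    rw [funext_iff]
    refine forall_congr' fun s => ?_
    rw [Matrix.sub_mulVec, Matrix.one_mulVec, Matrix.smul_mulVec]
    simp only [Pi.sub_apply, Pi.smul_apply, smul_eq_mul, Matrix.mulVec, dotProduct]
    constructor <;> intro h <;> linarith
  rw [← key]
  constructor
  · rintro rfl
    rw [discountedValue, Matrix.mulVec_mulVec, Matrix.mul_nonsing_inv _ hu, Matrix.one_mulVec]
  · intro h
    rw [discountedValue, ← h, Matrix.mulVec_mulVec, Matrix.nonsing_inv_mul _ hu,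
      Matrix.one_mulVec]

/-- `(μ₀, ν₀)` is a pair of (stationary) equilibrium strategies: both are vectors of mixed
strategies, and they satisfy the saddle-point inequality, which is an inequality of vectors
indexed by the state. -/
def IsEquilibrium [DecidableEq σ] (μ₀ ν₀ : σ → Measure unitInterval) : Prop :=
  IsMixedStrategy μ₀ ∧ IsMixedStrategy ν₀ ∧
    ∀ μ ν : σ → Measure unitInterval, IsMixedStrategy μ → IsMixedStrategy ν →
      G.discountedValue μ ν₀ ≤ G.discountedValue μ₀ ν₀ ∧
        G.discountedValue μ₀ ν₀ ≤ G.discountedValue μ₀ ν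

/-- The polynomial
`v(s) - ∑_{i,j} r_{ij}(s) ν_j(s) a₁ ^ i - β ∑_{s'} p(s'; s, a₁) v(s')` in `a₁`. -/
def primalPoly {m : ℕ} (n : ℕ) (νbar : σ → Fin (m + 1) → ℝ) (v : σ → ℝ) (s : σ) :
    Polynomial ℝ :=
  Polynomial.C (v s)
    - ∑ i : Fin (n + 1), ∑ j : Fin (m + 1),
        Polynomial.C (G.payoffCoeff s i j * νbar s j) * Polynomial.X ^ (i : ℕ)
    - Polynomial.C G.β * ∑ s', G.p s' s * Polynomial.C (v s')

/-- Feasibility in the primal program `(P')`: minimize `∑ s, v s` over `(νbar, v)`. -/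
def PrimalFeasible {m : ℕ} (n : ℕ) (νbar : σ → Fin (m + 1) → ℝ) (v : σ → ℝ) : Prop :=
  (∀ s, G.primalPoly n νbar v s ∈ nonnegPolys) ∧
    ∀ s, νbar s ∈ momentSpace m ∧ νbar s 0 = 1

/-- Feasibility in the dual program `(D')`: maximize `∑ s, α s` over `(ξbar, α)`. -/
def DualFeasible [DecidableEq σ] {n : ℕ} (m : ℕ) (ξbar : σ → Fin (n + 1) → ℝ) (α : σ → ℝ) :
    Prop :=
  (∀ s, ∀ a₂ ∈ Set.Icc (0 : ℝ) 1,
      0 ≤ (∑ i : Fin (n + 1), ∑ j : Fin (m + 1),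
        G.payoffCoeff s i j * ξbar s i * a₂ ^ (j : ℕ)) - α s) ∧
    (∀ s, ξbar s ∈ momentSpace n) ∧
    ∀ s', ∑ s, momentIntegral (ξbar s)
      (Polynomial.C (if s = s' then (1 : ℝ) else 0) - Polynomial.C G.β * G.p s' s) = 1

/-- The set of objective values of feasible points of `(P')`. -/
def primalValues (n m : ℕ) : Set ℝ :=
  {c | ∃ (νbar : σ → Fin (m + 1) → ℝ) (v : σ → ℝ), G.PrimalFeasible n νbar v ∧ c = ∑ s, v s}

/-- The set of objective values of feasible points of `(D')`. -/
def dualValues [DecidableEq σ] (n m : ℕ) : Set ℝ :=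
  {c | ∃ (ξbar : σ → Fin (n + 1) → ℝ) (α : σ → ℝ), G.DualFeasible m ξbar α ∧ c = ∑ s, α s}

/-- `(νbar, v)` is an optimal solution of `(P')`. -/
def PrimalOptimal {m : ℕ} (n : ℕ) (νbar : σ → Fin (m + 1) → ℝ) (v : σ → ℝ) : Prop :=
  G.PrimalFeasible n νbar v ∧ ∀ c ∈ G.primalValues n m, ∑ s, v s ≤ c

/-- `(ξbar, α)` is an optimal solution of `(D')`. -/
def DualOptimal [DecidableEq σ] {n : ℕ} (m : ℕ) (ξbar : σ → Fin (n + 1) → ℝ) (α : σ → ℝ) :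
    Prop :=
  G.DualFeasible m ξbar α ∧ ∀ c ∈ G.dualValues n m, c ≤ ∑ s, α s

end SingleControllerGame

/-- Total mass of a measure, used to normalize: `ξ / ξ([0,1])`. -/
def normalizeMeasure (ξ : Measure unitInterval) : Measure unitInterval :=
  (ξ Set.univ)⁻¹ • ξ

end

/-!
The value of the game comes from Shapley's operator. For continuation values `v`, each state carries
a one-stage game whose payoff `SingleControllerGame.shapleyPayoff` is affine in the moment vectors
of each of the two actions. The moment vectors of probability measures form a nonempty compact
convex set (`isCompact_probMomentSpace`, `convex_probMomentSpace`), so the minimax theorem gives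
these games values and optimal strategies. The map from `v` to the vector of values is a
`β`-contraction, and at its fixed point the optimal strategies `x`, `y` of the one-stage games are
stationary optimal strategies (`SingleControllerGame.DegreeLE.exists_value`).

Because player 1 alone controls the transitions, optimality of `y` is a family of inequalities that
are linear in `(y, v)`, namely feasibility in `(P')`. Multiplying `x s` by the nonnegative occupation
numbers `c s`, which solve `cᵀ (I - β P) = 1ᵀ` (`exists_nonneg_occupation`), gives a feasible point
of `(D')` with the same objective value. Weak duality then makes both points optimal and the two
optimal values equal (`SingleControllerGame.DegreeLE.exists_feasible_sum_eq`,
`SingleControllerGame.weak_duality`).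

For arbitrary optimal solutions, the duality gap is a sum of nonnegative terms
(`SingleControllerGame.DualFeasible.sum_sub_sum`), all of which must vanish
(`SingleControllerGame.complementary_slackness`). The flow constraint of `(D')` forces
`ξ₀(s) > 0`, so the slackness relations can be divided by the total mass. They then say that `v`
satisfies the recursion that characterizes `v_β(μ*, ν*)`, and that `ν*` minimizes the stage payoff
against `μ*`. With primal feasibility this bounds `v` by the one-stage payoffs under unilateral
deviations, and the comparison principle `nonneg_of_discounted_le` turns these bounds into the
saddle-point inequalities.
-/

open MeasureTheory

/-! ### Moments of measures on the unit interval -/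

theorem unitInterval.integrable_of_continuous {μ : Measure unitInterval} [IsFiniteMeasure μ]
    {f : unitInterval → ℝ} (hf : Continuous f) : Integrable f μ :=
  hf.integrable_of_hasCompactSupport (HasCompactSupport.of_compactSpace _)

namespace HasMoments

variable {n : ℕ} {μ ν : Measure unitInterval} {x y : Fin (n + 1) → ℝ}

theorem zero_eq (h : HasMoments μ x) : x 0 = μ.real Set.univ := by
  simp [h 0]

theorem zero_eq_one [IsProbabilityMeasure μ] (h : HasMoments μ x) : x 0 = 1 := by
  simp [h.zero_eq]

theorem smul (h : HasMoments μ x) {c : ℝ} (hc : 0 ≤ c) :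
    HasMoments (ENNReal.ofReal c • μ) (c • x) := by
  intro k
  simp [integral_smul_measure, ENNReal.toReal_ofReal hc, h k]

theorem add [IsFiniteMeasure μ] [IsFiniteMeasure ν] (hx : HasMoments μ x) (hy : HasMoments ν y) :
    HasMoments (μ + ν) (x + y) := by
  intro k
  rw [integral_add_measure
    (unitInterval.integrable_of_continuous (by fun_prop))
    (unitInterval.integrable_of_continuous (by fun_prop)), Pi.add_apply, hx k, hy k]

theorem momentIntegral_nonneg [IsFiniteMeasure μ] (h : HasMoments μ x) {q : Polynomial ℝ}
    (hq : q.natDegree ≤ n) (hq0 : q ∈ nonnegPolys) : 0 ≤ momentIntegral x q := by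
  rw [momentIntegral_eq_integral h hq]
  exact integral_nonneg fun a => hq0 a a.2

theorem isProbabilityMeasure [IsFiniteMeasure μ] (h : HasMoments μ x) (h0 : x 0 = 1) :
    IsProbabilityMeasure μ := by
  rw [h.zero_eq] at h0
  exact ⟨by simpa [Measure.real, ENNReal.toReal_eq_one_iff] using h0⟩

theorem isProbabilityMeasure_normalizeMeasure [IsFiniteMeasure μ] (h : HasMoments μ x)
    (h0 : 0 < x 0) : IsProbabilityMeasure (normalizeMeasure μ) := by
  have h1 : μ Set.univ ≠ 0 := fun h' => by simp [h.zero_eq, Measure.real, h'] at h0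
  exact ⟨by simp [normalizeMeasure, ENNReal.inv_mul_cancel h1 (measure_ne_top _ _)]⟩

theorem normalizeMeasure (h : HasMoments μ x) :
    HasMoments (normalizeMeasure μ) ((x 0)⁻¹ • x) := by
  intro k
  simp [_root_.normalizeMeasure, h k, h.zero_eq, Measure.real]

end HasMoments

/-- The vectors of the first `n + 1` moments of the probability measures on `[0,1]`. -/
def probMomentSpace (n : ℕ) : Set (Fin (n + 1) → ℝ) :=
  {y | ∃ μ : Measure unitInterval, IsProbabilityMeasure μ ∧ HasMoments μ y}

theorem probMomentSpace_subset_momentSpace (n : ℕ) : probMomentSpace n ⊆ momentSpace n :=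
  fun _ ⟨μ, _, h⟩ => ⟨μ, inferInstance, h⟩

theorem smul_mem_momentSpace {n : ℕ} {x : Fin (n + 1) → ℝ} (hx : x ∈ momentSpace n) {c : ℝ}
    (hc : 0 ≤ c) : c • x ∈ momentSpace n := by
  obtain ⟨μ, _, h⟩ := hx
  exact ⟨_, μ.smul_finite ENNReal.ofReal_ne_top, h.smul hc⟩

theorem hasMoments_dirac (n : ℕ) (t : unitInterval) :
    HasMoments (Measure.dirac t) fun k : Fin (n + 1) => (t : ℝ) ^ (k : ℕ) := by
  intro k
  rw [integral_dirac]

theorem pow_mem_probMomentSpace (n : ℕ) (t : unitInterval) :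
    (fun k : Fin (n + 1) => (t : ℝ) ^ (k : ℕ)) ∈ probMomentSpace n :=
  ⟨Measure.dirac t, inferInstance, hasMoments_dirac n t⟩

theorem probMomentSpace_nonempty (n : ℕ) : (probMomentSpace n).Nonempty :=
  ⟨_, pow_mem_probMomentSpace n 0⟩

theorem convex_probMomentSpace (n : ℕ) : Convex ℝ (probMomentSpace n) := by
  rintro x ⟨μ, _, hx⟩ y ⟨ν, _, hy⟩ a b ha hb hab
  have hμ : IsFiniteMeasure (ENNReal.ofReal a • μ) := μ.smul_finite ENNReal.ofReal_ne_top
  have hν : IsFiniteMeasure (ENNReal.ofReal b • ν) := ν.smul_finite ENNReal.ofReal_ne_top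
  have h := (hx.smul ha).add (hy.smul hb)
  refine ⟨_, h.isProbabilityMeasure ?_, h⟩
  simp [hx.zero_eq_one, hy.zero_eq_one, hab]

/-- The probability measures on `[0,1]` form a compact space for weak convergence, and the moments
are weakly continuous. -/
theorem isCompact_probMomentSpace (n : ℕ) : IsCompact (probMomentSpace n) := by
  let Φ : ProbabilityMeasure unitInterval → Fin (n + 1) → ℝ :=
    fun μ k => ∫ x : unitInterval, (x : ℝ) ^ (k : ℕ) ∂(μ : Measure unitInterval)
  have hΦ : Continuous Φ := by
    refine continuous_pi fun k => continuous_iff_continuousAt.2 fun μ => ?_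
    exact ProbabilityMeasure.tendsto_iff_forall_integral_tendsto.1 Filter.tendsto_id
      (BoundedContinuousFunction.mkOfCompact
        (⟨fun x : unitInterval => (x : ℝ) ^ (k : ℕ), by fun_prop⟩ : C(unitInterval, ℝ)))
  have h : probMomentSpace n = Set.range Φ := by
    ext y
    constructor
    · rintro ⟨μ, hμ, hy⟩
      exact ⟨⟨μ, hμ⟩, funext fun k => (hy k).symm⟩
    · rintro ⟨μ, rfl⟩
      exact ⟨μ, inferInstance, fun _ => rfl⟩
  rw [h]
  exact isCompact_range hΦ

theorem IsMixedStrategy.exists_hasMoments {σ : Type*} {μ : σ → Measure unitInterval}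
    (hμ : IsMixedStrategy μ) (n : ℕ) :
    ∃ x : σ → Fin (n + 1) → ℝ, (∀ s, HasMoments (μ s) (x s)) ∧ ∀ s, x s ∈ probMomentSpace n :=
  ⟨fun s k => ∫ a : unitInterval, (a : ℝ) ^ (k : ℕ) ∂(μ s), fun _ _ => rfl,
    fun s => ⟨μ s, hμ s, fun _ => rfl⟩⟩

/-! ### The linear form defined by a moment vector -/

section momentIntegral

variable {n : ℕ} (x y : Fin (n + 1) → ℝ)

theorem momentIntegral_smul (c : ℝ) (q : Polynomial ℝ) :
    momentIntegral (c • x) q = c * momentIntegral x q := by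
  simp only [momentIntegral, Finset.mul_sum, Pi.smul_apply, smul_eq_mul]
  exact Finset.sum_congr rfl fun _ _ => by ring

theorem momentIntegral_add (q : Polynomial ℝ) :
    momentIntegral (x + y) q = momentIntegral x q + momentIntegral y q := by
  simp only [momentIntegral, ← Finset.sum_add_distrib, Pi.add_apply, mul_add]

theorem momentIntegral_sub_right (q q' : Polynomial ℝ) :
    momentIntegral x (q - q') = momentIntegral x q - momentIntegral x q' := by
  simp only [momentIntegral, ← Finset.sum_sub_distrib, Polynomial.coeff_sub, sub_mul]

theorem momentIntegral_sum_right {ι : Type*} (S : Finset ι) (q : ι → Polynomial ℝ) :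
    momentIntegral x (∑ i ∈ S, q i) = ∑ i ∈ S, momentIntegral x (q i) := by
  simp only [momentIntegral, Polynomial.finsetSum_coeff, Finset.sum_mul]
  rw [Finset.sum_comm]

theorem momentIntegral_C_mul (c : ℝ) (q : Polynomial ℝ) :
    momentIntegral x (Polynomial.C c * q) = c * momentIntegral x q := by
  simp only [momentIntegral, Polynomial.coeff_C_mul, Finset.mul_sum, mul_assoc]

theorem momentIntegral_X_pow (i : Fin (n + 1)) :
    momentIntegral x (Polynomial.X ^ (i : ℕ)) = x i := by
  rw [momentIntegral, Finset.sum_eq_single i]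
  · simp
  · intro j _ hj
    simp [Polynomial.coeff_X_pow, Fin.val_ne_of_ne hj]
  · simp

theorem momentIntegral_C (c : ℝ) : momentIntegral x (Polynomial.C c) = c * x 0 := by
  have h := momentIntegral_C_mul x c (Polynomial.X ^ ((0 : Fin (n + 1)) : ℕ))
  rw [momentIntegral_X_pow] at h
  simpa using h

theorem continuous_momentIntegral (q : Polynomial ℝ) :
    Continuous fun x : Fin (n + 1) → ℝ => momentIntegral x q := by
  unfold momentIntegral
  fun_prop

end momentIntegral

/-- Point masses detect nonnegativity on `[0,1]`. -/
theorem mem_nonnegPolys_of_momentIntegral_nonneg {n : ℕ} {q : Polynomial ℝ} (hq : q.natDegree ≤ n)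
    (h : ∀ x ∈ probMomentSpace n, 0 ≤ momentIntegral x q) : q ∈ nonnegPolys := by
  intro a ha
  have h1 := h _ (pow_mem_probMomentSpace n ⟨a, ha⟩)
  rwa [momentIntegral_eq_integral (hasMoments_dirac n ⟨a, ha⟩) hq, integral_dirac] at h1

/-! ### Discounted stochastic matrices -/

/-- Comparison principle for discounted stochastic matrices: evaluate the inequality in a state
where `w` is minimal. -/
theorem nonneg_of_discounted_le {σ : Type*} [Fintype σ] {P : Matrix σ σ ℝ} {β : ℝ}
    (hβ0 : 0 ≤ β) (hβ1 : β < 1) (hP : ∀ i j, 0 ≤ P i j) (hP1 : ∀ i, ∑ j, P i j = 1) {w : σ → ℝ}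
    (hw : ∀ i, β * ∑ j, P i j * w j ≤ w i) : 0 ≤ w := by
  intro i
  have : Nonempty σ := ⟨i⟩
  obtain ⟨k, hk⟩ := Finite.exists_min w
  have h1 : w k ≤ ∑ j, P k j * w j := by
    calc w k = ∑ j, P k j * w k := by rw [← Finset.sum_mul, hP1, one_mul]
      _ ≤ _ := Finset.sum_le_sum fun j _ => mul_le_mul_of_nonneg_left (hk j) (hP k j)
  have h2 := mul_le_mul_of_nonneg_left h1 hβ0
  have h3 := hw k
  have h4 : 0 ≤ w k := by
    by_contra h
    nlinarith
  exact h4.trans (hk i)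

open scoped Matrix in
/-- Nonnegative solution of the transposed discounted system, the discounted occupation numbers of
the states. Nonnegativity is dual to the comparison principle `nonneg_of_discounted_le`. -/
theorem exists_nonneg_occupation {σ : Type*} [Fintype σ] [DecidableEq σ] {P : Matrix σ σ ℝ} {β : ℝ}
    (hβ0 : 0 ≤ β) (hβ1 : β < 1) (hP : ∀ i j, 0 ≤ P i j) (hP1 : ∀ i, ∑ j, P i j = 1)
    (hu : IsUnit (1 - β • P).det) :
    ∃ c : σ → ℝ, 0 ≤ c ∧ ∀ j, c j - β * ∑ i, c i * P i j = 1 := by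
  set A := 1 - β • P with hA
  have hinv (j : σ) : 0 ≤ A⁻¹ *ᵥ Pi.single j 1 := by
    refine nonneg_of_discounted_le hβ0 hβ1 hP hP1 fun i => ?_
    have h : A *ᵥ (A⁻¹ *ᵥ Pi.single j 1) = Pi.single j 1 := by
      rw [Matrix.mulVec_mulVec, Matrix.mul_nonsing_inv _ hu, Matrix.one_mulVec]
    have h1 := congrFun h i
    rw [hA, Matrix.sub_mulVec, Matrix.one_mulVec, Matrix.smul_mulVec] at h1
    simp only [Pi.sub_apply, Pi.smul_apply, smul_eq_mul] at h1
    have h2 : (0 : ℝ) ≤ (Pi.single j 1 : σ → ℝ) i :=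
      (Pi.single_nonneg.2 zero_le_one : (0 : σ → ℝ) ≤ Pi.single j 1) i
    rw [← h1] at h2
    exact sub_nonneg.1 h2
  refine ⟨1 ᵥ* A⁻¹, fun j => ?_, fun j => ?_⟩
  · have h : (1 ᵥ* A⁻¹) j = 1 ⬝ᵥ (A⁻¹ *ᵥ Pi.single j 1) := by
      rw [Matrix.dotProduct_mulVec, dotProduct_single_one]
    rw [h]
    exact Finset.sum_nonneg fun i _ => mul_nonneg zero_le_one (hinv j i)
  · have h : (1 ᵥ* A⁻¹) ᵥ* A = 1 := by
      rw [Matrix.vecMul_vecMul, Matrix.nonsing_inv_mul _ hu, Matrix.vecMul_one]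
    have h1 := congrFun h j
    rw [hA, Matrix.vecMul_sub, Matrix.vecMul_one, Matrix.vecMul_smul, ← hA] at h1
    exact h1

/-! ### The game in terms of moments -/

namespace SingleControllerGame

variable {σ : Type*} [Fintype σ] (G : SingleControllerGame σ) {n m : ℕ}

/-- The expected one-stage payoff `∑ r_{ij}(s) x_i y_j` in state `s`, as a bilinear form in the
moment vectors `x` and `y` of the two actions. -/
noncomputable def payoffForm (s : σ) (x : Fin (n + 1) → ℝ) (y : Fin (m + 1) → ℝ) : ℝ :=
  ∑ i : Fin (n + 1), ∑ j : Fin (m + 1), G.payoffCoeff s i j * x i * y j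

theorem payoffForm_smul_left (s : σ) (c : ℝ) (x : Fin (n + 1) → ℝ) (y : Fin (m + 1) → ℝ) :
    G.payoffForm s (c • x) y = c * G.payoffForm s x y := by
  simp only [payoffForm, Finset.mul_sum, Pi.smul_apply, smul_eq_mul]
  exact Finset.sum_congr rfl fun _ _ => Finset.sum_congr rfl fun _ _ => by ring

theorem payoffForm_smul_right (s : σ) (c : ℝ) (x : Fin (n + 1) → ℝ) (y : Fin (m + 1) → ℝ) :
    G.payoffForm s x (c • y) = c * G.payoffForm s x y := by
  simp only [payoffForm, Finset.mul_sum, Pi.smul_apply, smul_eq_mul]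
  exact Finset.sum_congr rfl fun _ _ => Finset.sum_congr rfl fun _ _ => by ring

theorem payoffForm_add_left (s : σ) (x x' : Fin (n + 1) → ℝ) (y : Fin (m + 1) → ℝ) :
    G.payoffForm s (x + x') y = G.payoffForm s x y + G.payoffForm s x' y := by
  simp only [payoffForm, ← Finset.sum_add_distrib, Pi.add_apply]
  exact Finset.sum_congr rfl fun _ _ => Finset.sum_congr rfl fun _ _ => by ring

theorem payoffForm_add_right (s : σ) (x : Fin (n + 1) → ℝ) (y y' : Fin (m + 1) → ℝ) :
    G.payoffForm s x (y + y') = G.payoffForm s x y + G.payoffForm s x y' := by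
  simp only [payoffForm, ← Finset.sum_add_distrib, Pi.add_apply]
  exact Finset.sum_congr rfl fun _ _ => Finset.sum_congr rfl fun _ _ => by ring

theorem continuous_payoffForm (s : σ) :
    Continuous fun z : (Fin (n + 1) → ℝ) × (Fin (m + 1) → ℝ) => G.payoffForm s z.1 z.2 := by
  unfold payoffForm
  fun_prop

theorem integral_payoffForm_left (s : σ) {μ : Measure unitInterval} [IsFiniteMeasure μ]
    {x : Fin (n + 1) → ℝ} (hx : HasMoments μ x) (y : Fin (m + 1) → ℝ) :
    ∫ a : unitInterval, G.payoffForm s (fun i : Fin (n + 1) => (a : ℝ) ^ (i : ℕ)) y ∂μ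
      = G.payoffForm s x y := by
  unfold payoffForm
  rw [integral_finsetSum _ fun i _ => unitInterval.integrable_of_continuous (by fun_prop)]
  refine Finset.sum_congr rfl fun i _ => ?_
  rw [integral_finsetSum _ fun j _ => unitInterval.integrable_of_continuous (by fun_prop)]
  refine Finset.sum_congr rfl fun j _ => ?_
  rw [integral_mul_const, integral_const_mul, hx i]

theorem integral_payoffForm_right (s : σ) {ν : Measure unitInterval} [IsFiniteMeasure ν]
    (x : Fin (n + 1) → ℝ) {y : Fin (m + 1) → ℝ} (hy : HasMoments ν y) :
    ∫ b : unitInterval, G.payoffForm s x (fun j : Fin (m + 1) => (b : ℝ) ^ (j : ℕ)) ∂ν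
      = G.payoffForm s x y := by
  unfold payoffForm
  rw [integral_finsetSum _ fun i _ => unitInterval.integrable_of_continuous (by fun_prop)]
  refine Finset.sum_congr rfl fun i _ => ?_
  rw [integral_finsetSum _ fun j _ => unitInterval.integrable_of_continuous (by fun_prop)]
  refine Finset.sum_congr rfl fun j _ => ?_
  rw [integral_const_mul, hy j]

variable {G}

theorem DegreeLE.evalEval_eq_payoffForm (hdeg : G.DegreeLE n m) (s : σ) (a b : ℝ) :
    (G.r s).evalEval a b = G.payoffForm s (fun i : Fin (n + 1) => a ^ (i : ℕ))
      (fun j : Fin (m + 1) => b ^ (j : ℕ)) := by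
  rw [Polynomial.evalEval, Polynomial.eval_eq_sum_range' (Nat.lt_succ_of_le (hdeg.2.2 s)),
    Finset.sum_range, Polynomial.eval_finsetSum, payoffForm, Finset.sum_comm]
  refine Finset.sum_congr rfl fun j _ => ?_
  rw [Polynomial.eval_mul, Polynomial.eval_eq_sum_range' (Nat.lt_succ_of_le (hdeg.2.1 s j)),
    Finset.sum_range, Finset.sum_mul]
  simp [payoffCoeff]

theorem DegreeLE.stagePayoff_eq (hdeg : G.DegreeLE n m) {μ ν : σ → Measure unitInterval} {s : σ}
    [IsFiniteMeasure (μ s)] [IsFiniteMeasure (ν s)] {x : Fin (n + 1) → ℝ} {y : Fin (m + 1) → ℝ}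
    (hx : HasMoments (μ s) x) (hy : HasMoments (ν s) y) :
    G.stagePayoff μ ν s = G.payoffForm s x y := by
  simp only [stagePayoff, hdeg.evalEval_eq_payoffForm, G.integral_payoffForm_left s hx,
    G.integral_payoffForm_right s x hy]

theorem DegreeLE.transitionMatrix_eq (hdeg : G.DegreeLE n m) {μ : σ → Measure unitInterval}
    {s : σ} [IsFiniteMeasure (μ s)] {x : Fin (n + 1) → ℝ} (hx : HasMoments (μ s) x) (s' : σ) :
    G.transitionMatrix μ s s' = momentIntegral x (G.p s' s) :=
  (momentIntegral_eq_integral hx (hdeg.1 s' s)).symm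

theorem DegreeLE.momentIntegral_p_nonneg (hdeg : G.DegreeLE n m) {x : Fin (n + 1) → ℝ}
    (hx : x ∈ momentSpace n) (s' s : σ) : 0 ≤ momentIntegral x (G.p s' s) := by
  obtain ⟨μ, _, h⟩ := hx
  exact h.momentIntegral_nonneg (hdeg.1 s' s) (G.p_nonneg s' s)

theorem DegreeLE.sum_momentIntegral_p (hdeg : G.DegreeLE n m) {x : Fin (n + 1) → ℝ}
    (hx : x ∈ probMomentSpace n) (s : σ) : ∑ s', momentIntegral x (G.p s' s) = 1 := by
  obtain ⟨μ, _, h⟩ := hx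
  simp_rw [momentIntegral_eq_integral h (hdeg.1 _ s)]
  rw [← integral_finsetSum _ fun i _ => unitInterval.integrable_of_continuous (by fun_prop)]
  have h1 (a : unitInterval) : ∑ s', (G.p s' s).eval (a : ℝ) = 1 := G.p_sum s a a.2
  simp [h1]

theorem DegreeLE.nonneg_of_discounted_le (hdeg : G.DegreeLE n m) {x : σ → Fin (n + 1) → ℝ}
    (hx : ∀ s, x s ∈ probMomentSpace n) {w : σ → ℝ}
    (hw : ∀ s, G.β * ∑ s', momentIntegral (x s) (G.p s' s) * w s' ≤ w s) : 0 ≤ w :=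
  _root_.nonneg_of_discounted_le
    (P := Matrix.of fun s s' => momentIntegral (x s) (G.p s' s)) G.β_nonneg G.β_lt_one
    (fun s s' => hdeg.momentIntegral_p_nonneg (probMomentSpace_subset_momentSpace n (hx s)) s' s)
    (fun s => hdeg.sum_momentIntegral_p (hx s) s) hw

/-- Integrating the primal constraint of state `s` against a measure with moment vector `x`. -/
theorem momentIntegral_primalPoly (s : σ) (x : Fin (n + 1) → ℝ)
    (νbar : σ → Fin (m + 1) → ℝ) (v : σ → ℝ) :
    momentIntegral x (G.primalPoly n νbar v s) = x 0 * v s - G.payoffForm s x (νbar s)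
      - G.β * ∑ s', momentIntegral x (G.p s' s) * v s' := by
  simp only [primalPoly, momentIntegral_sub_right, momentIntegral_sum_right, momentIntegral_C_mul,
    momentIntegral_X_pow, momentIntegral_C, payoffForm, mul_comm _ (Polynomial.C (v _))]
  congr 1
  · congr 1
    · ring
    · exact Finset.sum_congr rfl fun _ _ => Finset.sum_congr rfl fun _ _ => by ring
  · simp only [mul_comm]

theorem DegreeLE.natDegree_primalPoly_le (hdeg : G.DegreeLE n m)
    (νbar : σ → Fin (m + 1) → ℝ) (v : σ → ℝ) (s : σ) :
    (G.primalPoly n νbar v s).natDegree ≤ n := by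
  refine (Polynomial.natDegree_sub_le_of_le (m := n) (n := n) ?_ ?_).trans (max_self n).le
  · refine (Polynomial.natDegree_sub_le_of_le (m := n) (n := n) (by simp) ?_).trans (max_self n).le
    refine Polynomial.natDegree_sum_le_of_forall_le _ _ fun i _ =>
      Polynomial.natDegree_sum_le_of_forall_le _ _ fun j _ =>
        (Polynomial.natDegree_C_mul_X_pow_le _ _).trans (Nat.le_of_lt_succ i.2)
  · refine (Polynomial.natDegree_C_mul_le _ _).trans
      (Polynomial.natDegree_sum_le_of_forall_le _ _ fun s' _ => ?_)
    exact (Polynomial.natDegree_mul_C_le _ _).trans (hdeg.1 s' s)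

/-! ### Shapley's one-stage games and the value -/

/-- The payoff of the auxiliary one-stage game of Shapley in state `s`: the stage payoff plus the
discounted expectation of the continuation values `v`, in terms of the moments of the actions. -/
noncomputable def shapleyPayoff (G : SingleControllerGame σ) (v : σ → ℝ) (s : σ)
    (x : Fin (n + 1) → ℝ) (y : Fin (m + 1) → ℝ) : ℝ :=
  G.payoffForm s x y + G.β * ∑ s', momentIntegral x (G.p s' s) * v s'

theorem shapleyPayoff_combo_left (v : σ → ℝ) (s : σ) (x x' : Fin (n + 1) → ℝ)
    (y : Fin (m + 1) → ℝ) (a b : ℝ) :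
    G.shapleyPayoff v s (a • x + b • x') y
      = a * G.shapleyPayoff v s x y + b * G.shapleyPayoff v s x' y := by
  simp only [shapleyPayoff, payoffForm_add_left, payoffForm_smul_left, momentIntegral_add,
    momentIntegral_smul, add_mul, Finset.sum_add_distrib, mul_assoc, ← Finset.mul_sum]
  ring

theorem shapleyPayoff_combo_right (v : σ → ℝ) (s : σ) (x : Fin (n + 1) → ℝ)
    (y y' : Fin (m + 1) → ℝ) {a b : ℝ} (hab : a + b = 1) :
    G.shapleyPayoff v s x (a • y + b • y')
      = a * G.shapleyPayoff v s x y + b * G.shapleyPayoff v s x y' := by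
  simp only [shapleyPayoff, payoffForm_add_right, payoffForm_smul_right]
  linear_combination
    -(G.β * ∑ s', momentIntegral x (G.p s' s) * v s') * hab

theorem continuous_shapleyPayoff (v : σ → ℝ) (s : σ) :
    Continuous fun z : (Fin (n + 1) → ℝ) × (Fin (m + 1) → ℝ) => G.shapleyPayoff v s z.1 z.2 := by
  have h (s') := (continuous_momentIntegral (n := n) (G.p s' s)).comp
    (continuous_fst (X := Fin (n + 1) → ℝ) (Y := Fin (m + 1) → ℝ))
  exact (G.continuous_payoffForm s).add
    (continuous_const.mul (continuous_finsetSum _ fun s' _ => (h s').mul continuous_const))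

/-- The auxiliary one-stage game has a value, by the minimax theorem of Sion and von Neumann. -/
theorem exists_saddlePoint_shapleyPayoff (G : SingleControllerGame σ) (n m : ℕ) (v : σ → ℝ)
    (s : σ) :
    ∃ x ∈ probMomentSpace n, ∃ y ∈ probMomentSpace m,
      ∀ x' ∈ probMomentSpace n, ∀ y' ∈ probMomentSpace m,
        G.shapleyPayoff v s x' y ≤ G.shapleyPayoff v s x y' := by
  have hc := G.continuous_shapleyPayoff (n := n) (m := m) v s
  obtain ⟨y, hy, x, hx, h⟩ := Sion.exists_isSaddlePointOn (X := probMomentSpace m)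
    (Y := probMomentSpace n) (f := fun y x => G.shapleyPayoff v s x y)
    (probMomentSpace_nonempty m) (convex_probMomentSpace m) (isCompact_probMomentSpace m)
    (fun x _ => (hc.comp (Continuous.prodMk_right x)).lowerSemicontinuous.lowerSemicontinuousOn _)
    (fun x _ => ConvexOn.quasiconvexOn ⟨convex_probMomentSpace m, fun y _ y' _ a b _ _ hab =>
      (shapleyPayoff_combo_right v s x y y' hab).le⟩)
    (convex_probMomentSpace n) (probMomentSpace_nonempty n) (isCompact_probMomentSpace n)
    (fun y _ => (hc.comp (Continuous.prodMk_left y)).upperSemicontinuous.upperSemicontinuousOn _)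
    (fun y _ => ConcaveOn.quasiconcaveOn ⟨convex_probMomentSpace n, fun x _ x' _ a b _ _ _ =>
      (shapleyPayoff_combo_left v s x x' y a b).ge⟩)
  exact ⟨x, hx, y, hy, fun x' hx' y' hy' => h y' hy' x' hx'⟩

/-- The one-stage payoff is `β`-Lipschitz in the continuation values, since the transition
probabilities are nonnegative with sum one. -/
theorem DegreeLE.shapleyPayoff_le_add (hdeg : G.DegreeLE n m) (v w : σ → ℝ) (s : σ)
    {x : Fin (n + 1) → ℝ} (hx : x ∈ probMomentSpace n) (y : Fin (m + 1) → ℝ) :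
    G.shapleyPayoff v s x y ≤ G.shapleyPayoff w s x y + G.β * dist v w := by
  have hx' := probMomentSpace_subset_momentSpace n hx
  have h : ∑ s', momentIntegral x (G.p s' s) * v s'
      ≤ ∑ s', momentIntegral x (G.p s' s) * w s' + dist v w := by
    calc _ ≤ ∑ s', momentIntegral x (G.p s' s) * (w s' + dist v w) := by
          refine Finset.sum_le_sum fun s' _ =>
            mul_le_mul_of_nonneg_left ?_ (hdeg.momentIntegral_p_nonneg hx' s' s)
          have h1 := (le_abs_self _).trans (dist_le_pi_dist v w s')
          linarith
      _ = _ := by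
          simp only [mul_add, Finset.sum_add_distrib, ← Finset.sum_mul,
            hdeg.sum_momentIntegral_p hx s, one_mul]
  have h2 := mul_le_mul_of_nonneg_left h G.β_nonneg
  unfold shapleyPayoff
  linarith

/-- Shapley's theorem: the discounted game has a value vector `v` and stationary optimal
strategies. The operator which maps continuation values to the values of the auxiliary one-stage
games is a `β`-contraction for the sup norm; `v` is its fixed point. -/
theorem DegreeLE.exists_value (hdeg : G.DegreeLE n m) :
    ∃ (v : σ → ℝ) (x : σ → Fin (n + 1) → ℝ) (y : σ → Fin (m + 1) → ℝ),
      (∀ s, x s ∈ probMomentSpace n) ∧ (∀ s, y s ∈ probMomentSpace m) ∧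
      (∀ s, ∀ x' ∈ probMomentSpace n, G.shapleyPayoff v s x' (y s) ≤ v s) ∧
      ∀ s, ∀ y' ∈ probMomentSpace m, v s ≤ G.shapleyPayoff v s (x s) y' := by
  choose x hx y hy h using G.exists_saddlePoint_shapleyPayoff n m
  let T : (σ → ℝ) → σ → ℝ := fun v s => G.shapleyPayoff v s (x v s) (y v s)
  have hT (v w s) : T v s - T w s ≤ G.β * dist v w := by
    have h1 := h v s _ (hx v s) _ (hy w s)
    have h2 := hdeg.shapleyPayoff_le_add v w s (hx v s) (y w s)
    have h3 := h w s _ (hx v s) _ (hy w s)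
    simp only [T]
    linarith
  have hcontr : ContractingWith ⟨G.β, G.β_nonneg⟩ T := by
    refine ⟨by exact_mod_cast G.β_lt_one, LipschitzWith.of_dist_le_mul fun v w => ?_⟩
    refine (dist_pi_le_iff (mul_nonneg G.β_nonneg dist_nonneg)).2 fun s => ?_
    rw [Real.dist_eq, abs_sub_le_iff]
    exact ⟨hT v w s, by simpa [dist_comm] using hT w v s⟩
  have hfix : T hcontr.fixedPoint = hcontr.fixedPoint := hcontr.fixedPoint_isFixedPt
  generalize hcontr.fixedPoint = v at hfix
  refine ⟨v, x v, y v, hx v, hy v, fun s x' hx' => ?_, fun s y' hy' => ?_⟩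
  · rw [← congrFun hfix s]
    exact h v s x' hx' _ (hy v s)
  · conv_lhs => rw [← congrFun hfix s]
    exact h v s _ (hx v s) y' hy'

/-! ### Weak duality and complementary slackness -/

section Feasible

variable {νbar : σ → Fin (m + 1) → ℝ} {v : σ → ℝ} {ξbar : σ → Fin (n + 1) → ℝ} {α : σ → ℝ}

theorem PrimalFeasible.momentIntegral_primalPoly_nonneg (hP : G.PrimalFeasible n νbar v)
    (hdeg : G.DegreeLE n m) {s : σ} {x : Fin (n + 1) → ℝ} (hx : x ∈ momentSpace n) :
    0 ≤ momentIntegral x (G.primalPoly n νbar v s) := by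
  obtain ⟨μ, _, h⟩ := hx
  exact h.momentIntegral_nonneg (hdeg.natDegree_primalPoly_le νbar v s) (hP.1 s)

theorem PrimalFeasible.shapleyPayoff_le (hP : G.PrimalFeasible n νbar v)
    (hdeg : G.DegreeLE n m) (s : σ) {x : Fin (n + 1) → ℝ} (hx : x ∈ probMomentSpace n) :
    G.shapleyPayoff v s x (νbar s) ≤ v s := by
  have h := hP.momentIntegral_primalPoly_nonneg hdeg (s := s)
    (probMomentSpace_subset_momentSpace n hx)
  obtain ⟨μ, _, hμ⟩ := hx
  rw [momentIntegral_primalPoly, hμ.zero_eq_one] at h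
  unfold shapleyPayoff
  linarith

variable [DecidableEq σ]

theorem DualFeasible.le_payoffForm (hD : G.DualFeasible m ξbar α) (s : σ) {y : Fin (m + 1) → ℝ}
    (hy : y ∈ probMomentSpace m) : α s ≤ G.payoffForm s (ξbar s) y := by
  obtain ⟨ν, _, hν⟩ := hy
  have hc : Continuous fun b : unitInterval =>
      G.payoffForm s (ξbar s) (fun j : Fin (m + 1) => (b : ℝ) ^ (j : ℕ)) := by
    unfold payoffForm
    fun_prop
  calc α s = ∫ _ : unitInterval, α s ∂ν := by simp
    _ ≤ _ := integral_mono (integrable_const _) (unitInterval.integrable_of_continuous hc)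
        fun b => sub_nonneg.1 (hD.1 s b b.2)
    _ = _ := G.integral_payoffForm_right s _ hν

/-- The left side of the equality constraint of `(D')`: the mass in state `s'` minus the discounted
inflow into `s'`. -/
theorem sum_momentIntegral_flow (ξbar : σ → Fin (n + 1) → ℝ) (s' : σ) :
    ∑ s, momentIntegral (ξbar s)
      (Polynomial.C (if s = s' then (1 : ℝ) else 0) - Polynomial.C G.β * G.p s' s)
      = ξbar s' 0 - G.β * ∑ s, momentIntegral (ξbar s) (G.p s' s) := by
  simp only [momentIntegral_sub_right, momentIntegral_C, momentIntegral_C_mul,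
    Finset.sum_sub_distrib, Finset.mul_sum]
  simp

theorem DualFeasible.flow (hD : G.DualFeasible m ξbar α) (s' : σ) :
    ξbar s' 0 - G.β * ∑ s, momentIntegral (ξbar s) (G.p s' s) = 1 := by
  rw [← sum_momentIntegral_flow]
  exact hD.2.2 s'

theorem DualFeasible.zero_pos (hD : G.DualFeasible m ξbar α) (hdeg : G.DegreeLE n m) (s : σ) :
    0 < ξbar s 0 := by
  have h := hD.flow s
  have h1 := mul_nonneg G.β_nonneg (Finset.sum_nonneg fun i (_ : i ∈ Finset.univ) =>
    hdeg.momentIntegral_p_nonneg (hD.2.1 i) s i)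
  linarith

/-- The duality gap is the sum of the slacks of the primal and the dual inequality constraints,
weighted by the variables dual to them. -/
theorem DualFeasible.sum_sub_sum (hD : G.DualFeasible m ξbar α) (νbar : σ → Fin (m + 1) → ℝ)
    (v : σ → ℝ) :
    ∑ s, v s - ∑ s, α s = ∑ s, (momentIntegral (ξbar s) (G.primalPoly n νbar v s)
      + (G.payoffForm s (ξbar s) (νbar s) - α s)) := by
  have h : ∑ s, v s = ∑ s, ξbar s 0 * v s
      - ∑ s, G.β * ∑ s', momentIntegral (ξbar s) (G.p s' s) * v s' := by
    calc ∑ s, v s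
        = ∑ s', (ξbar s' 0 - G.β * ∑ s, momentIntegral (ξbar s) (G.p s' s)) * v s' := by
          simp only [hD.flow, one_mul]
      _ = _ := by
          simp only [sub_mul, Finset.sum_sub_distrib, Finset.mul_sum, Finset.sum_mul, mul_assoc]
          congr 1
          exact Finset.sum_comm
  simp only [momentIntegral_primalPoly, Finset.sum_add_distrib, Finset.sum_sub_distrib]
  rw [h]
  ring

end Feasible

theorem PrimalFeasible.mem_probMomentSpace {νbar : σ → Fin (m + 1) → ℝ} {v : σ → ℝ}
    (hP : G.PrimalFeasible n νbar v) (s : σ) : νbar s ∈ probMomentSpace m := by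
  obtain ⟨⟨ν, _, hν⟩, h1⟩ := hP.2 s
  exact ⟨ν, hν.isProbabilityMeasure h1, hν⟩

variable [DecidableEq σ]

theorem weak_duality (hdeg : G.DegreeLE n m)
    {νbar : σ → Fin (m + 1) → ℝ} {v : σ → ℝ} {ξbar : σ → Fin (n + 1) → ℝ} {α : σ → ℝ}
    (hP : G.PrimalFeasible n νbar v) (hD : G.DualFeasible m ξbar α) :
    ∑ s, α s ≤ ∑ s, v s := by
  rw [← sub_nonneg, hD.sum_sub_sum νbar v]
  exact Finset.sum_nonneg fun s _ => add_nonneg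
    (hP.momentIntegral_primalPoly_nonneg hdeg (hD.2.1 s))
    (sub_nonneg.2 (hD.le_payoffForm s (hP.mem_probMomentSpace s)))

theorem complementary_slackness (hdeg : G.DegreeLE n m)
    {νbar : σ → Fin (m + 1) → ℝ} {v : σ → ℝ} {ξbar : σ → Fin (n + 1) → ℝ} {α : σ → ℝ}
    (hP : G.PrimalFeasible n νbar v) (hD : G.DualFeasible m ξbar α)
    (h : ∑ s, v s = ∑ s, α s) (s : σ) :
    momentIntegral (ξbar s) (G.primalPoly n νbar v s) = 0 ∧
      G.payoffForm s (ξbar s) (νbar s) = α s := by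
  have hA (s) := hP.momentIntegral_primalPoly_nonneg hdeg (s := s) (hD.2.1 s)
  have hB (s) := sub_nonneg.2 (hD.le_payoffForm s (hP.mem_probMomentSpace s))
  have h0 := hD.sum_sub_sum νbar v
  rw [h, sub_self, eq_comm,
    Finset.sum_eq_zero_iff_of_nonneg fun s _ => add_nonneg (hA s) (hB s)] at h0
  have h1 := h0 s (Finset.mem_univ s)
  exact ⟨by linarith [hA s, hB s], by linarith [hA s, hB s]⟩

/-! ### Strong duality -/

/-- The value vector of the game and a stationary optimal strategy of player 2 solve `(P')`; a
stationary optimal strategy of player 1, weighted by its discounted occupation numbers, solves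
`(D')` with the same objective value. -/
theorem DegreeLE.exists_feasible_sum_eq (hdeg : G.DegreeLE n m) :
    ∃ (νbar : σ → Fin (m + 1) → ℝ) (v : σ → ℝ) (ξbar : σ → Fin (n + 1) → ℝ) (α : σ → ℝ),
      G.PrimalFeasible n νbar v ∧ G.DualFeasible m ξbar α ∧ ∑ s, v s = ∑ s, α s := by
  obtain ⟨v, x, y, hx, hy, hmax, hmin⟩ := hdeg.exists_value
  choose μ hμ hμx using hx
  have hx' (s) : x s ∈ probMomentSpace n := ⟨μ s, hμ s, hμx s⟩
  have hx0 (s) : x s 0 = 1 := (hμx s).zero_eq_one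
  have hPx (s s') : G.transitionMatrix μ s s' = momentIntegral (x s) (G.p s' s) :=
    hdeg.transitionMatrix_eq (hμx s) s'
  obtain ⟨c, hc, hflow⟩ := exists_nonneg_occupation G.β_nonneg G.β_lt_one
    (P := G.transitionMatrix μ)
    (fun s s' => by
      rw [hPx]
      exact hdeg.momentIntegral_p_nonneg (probMomentSpace_subset_momentSpace n (hx' s)) s' s)
    (fun s => by simp only [hPx, hdeg.sum_momentIntegral_p (hx' s)]) (G.isUnit_det hμ)
  have hD : G.DualFeasible m (fun s => c s • x s)
      (fun s => c s * (v s - G.β * ∑ s', momentIntegral (x s) (G.p s' s) * v s')) := by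
    refine ⟨fun s a ha => ?_, fun s =>
      smul_mem_momentSpace (probMomentSpace_subset_momentSpace n (hx' s)) (hc s), fun s' => ?_⟩
    · have h := hmin s _ (pow_mem_probMomentSpace m ⟨a, ha⟩)
      have h1 := mul_le_mul_of_nonneg_left (sub_le_iff_le_add.2 h) (hc s)
      rw [← payoffForm_smul_left] at h1
      exact sub_nonneg.2 h1
    · rw [sum_momentIntegral_flow, ← hflow s']
      simp [hx0, hPx, momentIntegral_smul]
  refine ⟨y, v, _, _, ⟨fun s => ?_, fun s => ?_⟩, hD, ?_⟩
  · refine mem_nonnegPolys_of_momentIntegral_nonneg (hdeg.natDegree_primalPoly_le y v s)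
      fun x' hx' => ?_
    have h := hmax s x' hx'
    obtain ⟨μ', _, hμ'⟩ := hx'
    rw [momentIntegral_primalPoly, hμ'.zero_eq_one]
    unfold shapleyPayoff at h
    linarith
  · obtain ⟨ν, _, hν⟩ := hy s
    exact ⟨probMomentSpace_subset_momentSpace m (hy s), hν.zero_eq_one⟩
  · -- in each state the weighted primal slack and the dual slack cancel, by the choice of `α`
    rw [← sub_eq_zero, hD.sum_sub_sum y v]
    refine Finset.sum_eq_zero fun s _ => ?_
    simp only [momentIntegral_primalPoly, momentIntegral_smul, Pi.smul_apply, smul_eq_mul, hx0,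
      mul_assoc, ← Finset.mul_sum]
    ring

/-! ### Bounds on discounted values -/

section Strategies

variable {μ ν : σ → Measure unitInterval} {x : σ → Fin (n + 1) → ℝ} {y : σ → Fin (m + 1) → ℝ}
  {v : σ → ℝ}

theorem DegreeLE.eq_discountedValue_iff (hdeg : G.DegreeLE n m) (hμ : IsMixedStrategy μ)
    (hν : IsMixedStrategy ν) (hx : ∀ s, HasMoments (μ s) (x s)) (hy : ∀ s, HasMoments (ν s) (y s)) :
    v = G.discountedValue μ ν ↔ ∀ s, v s = G.shapleyPayoff v s (x s) (y s) := by
  rw [G.eq_discountedValue_iff hμ]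
  refine forall_congr' fun s => ?_
  have := hμ s
  have := hν s
  simp only [hdeg.stagePayoff_eq (hx s) (hy s), hdeg.transitionMatrix_eq (hx s), shapleyPayoff]

/-- If `v` does not exceed the one-stage payoffs under `(μ, ν)` with continuation values `v`, then
it does not exceed the discounted value of `(μ, ν)`. -/
theorem DegreeLE.le_discountedValue (hdeg : G.DegreeLE n m) (hμ : IsMixedStrategy μ)
    (hν : IsMixedStrategy ν) (hx : ∀ s, HasMoments (μ s) (x s)) (hy : ∀ s, HasMoments (ν s) (y s))
    (hv : ∀ s, v s ≤ G.shapleyPayoff v s (x s) (y s)) : v ≤ G.discountedValue μ ν := by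
  have hu := (hdeg.eq_discountedValue_iff hμ hν hx hy).1 rfl
  refine sub_nonneg.1 (hdeg.nonneg_of_discounted_le (x := x)
    (fun s => ⟨μ s, hμ s, hx s⟩) fun s => ?_)
  have h1 := hu s
  have h2 := hv s
  simp only [shapleyPayoff] at h1 h2
  simp only [Pi.sub_apply, mul_sub, Finset.sum_sub_distrib]
  linarith

/-- The reverse of `DegreeLE.le_discountedValue`. -/
theorem DegreeLE.discountedValue_le (hdeg : G.DegreeLE n m) (hμ : IsMixedStrategy μ)
    (hν : IsMixedStrategy ν) (hx : ∀ s, HasMoments (μ s) (x s)) (hy : ∀ s, HasMoments (ν s) (y s))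
    (hv : ∀ s, G.shapleyPayoff v s (x s) (y s) ≤ v s) : G.discountedValue μ ν ≤ v := by
  have hu := (hdeg.eq_discountedValue_iff hμ hν hx hy).1 rfl
  refine sub_nonneg.1 (hdeg.nonneg_of_discounted_le (x := x)
    (fun s => ⟨μ s, hμ s, hx s⟩) fun s => ?_)
  have h1 := hu s
  have h2 := hv s
  simp only [shapleyPayoff] at h1 h2
  simp only [Pi.sub_apply, mul_sub, Finset.sum_sub_distrib]
  linarith

end Strategies

end SingleControllerGame

/-! ### Equilibria from optimal solutions -/

theorem mainTheorem1 {σ : Type*} [Fintype σ] [DecidableEq σ] (G : SingleControllerGame σ)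
    (n m : ℕ) (hdeg : G.DegreeLE n m) :
    (∃ pStar dStar : ℝ, IsLeast (G.primalValues n m) pStar ∧ IsGreatest (G.dualValues n m) dStar ∧
      pStar = dStar) ∧
    ∀ (νbar : σ → Fin (m + 1) → ℝ) (vStar : σ → ℝ)
      (ξbar : σ → Fin (n + 1) → ℝ) (αStar : σ → ℝ)
      (νStar ξStar : σ → Measure unitInterval),
      G.PrimalOptimal n νbar vStar → G.DualOptimal m ξbar αStar →
      (∀ s, IsFiniteMeasure (νStar s) ∧ HasMoments (νStar s) (νbar s)) →
      (∀ s, IsFiniteMeasure (ξStar s) ∧ HasMoments (ξStar s) (ξbar s)) →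
      vStar = G.discountedValue (fun s => normalizeMeasure (ξStar s)) νStar ∧
      G.IsEquilibrium (fun s => normalizeMeasure (ξStar s)) νStar := by
  obtain ⟨y₀, v₀, x₀, α₀, hP₀, hD₀, heq₀⟩ := hdeg.exists_feasible_sum_eq
  refine ⟨⟨∑ s, v₀ s, ∑ s, α₀ s, ⟨⟨y₀, v₀, hP₀, rfl⟩, ?_⟩, ⟨⟨x₀, α₀, hD₀, rfl⟩, ?_⟩, heq₀⟩, ?_⟩
  · rintro _ ⟨y, v, hP, rfl⟩
    exact heq₀.trans_le (SingleControllerGame.weak_duality hdeg hP hD₀)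
  · rintro _ ⟨x, α, hD, rfl⟩
    exact (SingleControllerGame.weak_duality hdeg hP₀ hD).trans_eq heq₀
  intro y v x α ν ξ ⟨hP, hPopt⟩ ⟨hD, hDopt⟩ hν hξ
  have hgap : ∑ s, v s = ∑ s, α s := by
    refine le_antisymm ?_ (SingleControllerGame.weak_duality hdeg hP hD)
    exact (hPopt _ ⟨y₀, v₀, hP₀, rfl⟩).trans (heq₀.trans_le (hDopt _ ⟨x₀, α₀, hD₀, rfl⟩))
  have hslack := SingleControllerGame.complementary_slackness hdeg hP hD hgap
  have hx0 := hD.zero_pos hdeg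
  have hνm (s) : HasMoments (ν s) (y s) := (hν s).2
  have hνmix : IsMixedStrategy ν := fun s =>
    have := (hν s).1
    (hνm s).isProbabilityMeasure (hP.2 s).2
  have hμmix : IsMixedStrategy fun s => normalizeMeasure (ξ s) := fun s =>
    have := (hξ s).1
    (hξ s).2.isProbabilityMeasure_normalizeMeasure (hx0 s)
  have hμm (s) : HasMoments (normalizeMeasure (ξ s)) ((x s 0)⁻¹ • x s) := (hξ s).2.normalizeMeasure
  have hrec (s) : v s = G.shapleyPayoff v s ((x s 0)⁻¹ • x s) (y s) := by
    have h := (hslack s).1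
    rw [SingleControllerGame.momentIntegral_primalPoly] at h
    simp only [SingleControllerGame.shapleyPayoff, SingleControllerGame.payoffForm_smul_left,
      momentIntegral_smul, mul_assoc, ← Finset.mul_sum]
    have h0 := (hx0 s).ne'
    field_simp
    linarith
  have hval := (hdeg.eq_discountedValue_iff hμmix hνmix hμm hνm).2 hrec
  refine ⟨hval, hμmix, hνmix, fun μ' ν' hμ' hν' => ?_⟩
  rw [← hval]
  obtain ⟨x', hx', hx'mem⟩ := hμ'.exists_hasMoments n
  obtain ⟨y', hy', hy'mem⟩ := hν'.exists_hasMoments m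
  refine ⟨hdeg.discountedValue_le hμ' hνmix hx' hνm fun s => hP.shapleyPayoff_le hdeg s (hx'mem s),
    hdeg.le_discountedValue hμmix hν' hμm hy' fun s => ?_⟩
  -- `y s` minimizes the stage payoff against the optimal dual strategy, by complementary slackness
  have hmin : G.payoffForm s (x s) (y s) ≤ G.payoffForm s (x s) (y' s) :=
    (hslack s).2.trans_le (hD.le_payoffForm s (hy'mem s))
  have h := mul_le_mul_of_nonneg_left hmin (inv_nonneg.2 (hx0 s).le)
  rw [← SingleControllerGame.payoffForm_smul_left, ← SingleControllerGame.payoffForm_smul_left] at h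
  rw [hrec s]
  unfold SingleControllerGame.shapleyPayoff
  linarith
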